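/- **Setting.** Let $G=(V,E)$ be a finite undirected graph with $n=|V|\ge 3$ vertices and positive edge weights $w$; let $k=\ln n$, $d\ge 2$ an integer, $c\ge 1$ and $\rho\ge 0$ real, and $s=4e\,d^{c+1}\ln^2 n+1$. The length of a path is the sum of its edge weights, and $\delta_H$ denotes distance in $H$. *Tree covers.* For disjoint $R,S\subseteq V$, an $S$-restricted tree cover of $G-R$ is a family of trees $T(x)\subseteq G-R$ ($x\in S$), $T(x)$ rooted at $x$, such that (i) for all $a\in S$, $b\in V\setminus R$ with $\delta_{G-R}(a,b)<\infty$ some $T(x)$ contains $a$ and $b$ and $\mathrm{dep}_{T(x)}(a)+\mathrm{dep}_{T(x)}(b)\le(2k-1)\delta_{G-R}(a,b)$, where $\mathrm{dep}_T$ is the weighted distance to the root in $T$, and (ii) every vertex lies in at most $kn^{1/k}(\ln n+1)$ of the trees. For all $R,S$ fix an $(S\setminus R)$-restricted tree cover $\mathcal T_R(S)$ of $G-R$, depending only on $R$ and $S\setminus R$, and put $\mathcal T(S)=\mathcal T_\varnothing(S)$. A trunk vertex of a tree $T$ of an $S$-restricted cover is a vertex on the path in $T$ between two vertices of $S$; the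 pseudo-degree of a vertex in $T$ is its degree in the subgraph of $T$ induced by the trunk vertices ($0$ for non-trunk vertices). $\mathrm{Hi}(\cdot)$ is the set of vertices of pseudo-degree $>s$ in some tree of the cover. *Hierarchy.* The hierarchy tree has root $V$; a node $A$ is a leaf if $\mathrm{Hi}(\mathcal T(A))=\varnothing$, and otherwise has children $W_1=\mathrm{Hi}(\mathcal T(A))$ and $W_{j}=W_{j-1}\cup\mathrm{Hi}(\mathcal T_{W_{j-1}}(A))$ for $2\le j\le d$. Let $V=U_1,\dots,U_p$ be a path in it starting at the root, and $U_{p+1}=\varnothing$. Let $\mathcal T$ be the family of all trees of $\mathcal T_{U_{i+1}}(U_i)$, $1\le i\le p$, each pruned by deleting the vertices of depth $>(2k-1)\rho$; a tree with index $i$ has its trunk taken, after pruning, with respect to $U_i\setminus U_{i+1}$. *Data structure.* Let $\Lambda$ be the concatenation, in some order, of Euler tours (depth-first discovery orders from the root) of the trees of $\mathcal T$. Let $\mathcal I$ be a $\kappa$-covering set of $\Lambda$ for some $\kappa$: a set of intervals of positions of $\Lambda$ such that each interval is the union of at most $\kappa$ members of $\mathcal I$. The digraph $H$ has as vertices two copies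 $I_1,I_2$ of each $I\in\mathcal I$, two copies $T_1,T_2$ of each $T\in\mathcal T$, and all $x\in V$. Its edges are $I_1\to T_1$ and $T_2\to I_2$ whenever an edge of $G$ of weight $\le\rho$ joins a vertex of $I$ to a vertex of $T$, and $T_1\to x$ and $x\to T_2$ whenever $x\in V(T)$. $E'$ is the set of pairs of positions of $\Lambda$ whose vertices are equal or are joined by an edge of $G$ of weight $\le\rho$. *Query.* Let $D\subseteq V$, $|D|\le d$, and $u,v\in V\setminus D$. A tree $T\in\mathcal T$ is affected if $V(T)\cap D\ne\varnothing$; its affected subtrees are the connected components of $T-D$ that contain a trunk vertex of $T$. A vertex is affected if it lies in some affected subtree, and unaffected otherwise. The nodes of the query graph $R$ are $\{u\}$, $\{v\}$ and all affected subtrees, considered as vertex sets, each represented as a union of intervals from $\mathcal I$ (intervals being read as the sets of vertices occurring in them). For nodes $X,Y$ (possibly $X=Y$), there is an undirected edge $(X,Y)\in E(R)$ iff there are intervals $I$ in the representation of $X$ and $J$ in that of $Y$, or vice versa, such that $I_1$ can reach $J_2$ in $H$ after deletion of both copies of all affected trees, or $E'\cap(I\times J)\neq\varnothing$. An unaffected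 path connecting $X$ and $Y$ is a path $(v_0,\dots,v_\ell)$, $\ell\ge 0$, in $G-D$ with $v_0\in X$, $v_\ell\in Y$ and $v_1,\dots,v_{\ell-1}$ unaffected. **Theorem.** For every choice of the above data and all nodes $X,Y$ of $R$: (a) if there is an unaffected path of length $\le\rho$ connecting $X$ and $Y$, then $(X,Y)\in E(R)$; (b) if $(X,Y)\in E(R)$, then there is a path in $G-D$ that starts at a vertex of $X$, ends at a vertex of $Y$, and has length at most $(8k-2)\rho$. -/

import Mathlib

namespace VSDO

/-! ### Weighted graphs -/

/-- The length of a walk, for edge weights `w`. -/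
noncomputable def wlen {V : Type*} {H : SimpleGraph V} (w : Sym2 V → ℝ) {a b : V}
    (q : H.Walk a b) : ℝ :=
  (q.edges.map w).sum

/-- The weighted distance between `a` and `b` in `H`. It is only used for vertices that are
connected in `H`. -/
noncomputable def wdist {V : Type*} (H : SimpleGraph V) (w : Sym2 V → ℝ) (a b : V) : ℝ :=
  sInf {L : ℝ | ∃ q : H.Walk a b, wlen w q = L}

/-- The graph `G - R`. -/
def minus {V : Type*} (G : SimpleGraph V) (R : Set V) : G.Subgraph :=
  (⊤ : G.Subgraph).deleteVerts R

/-- The parameter `k = ln n`, where `n = |V|`. -/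
noncomputable def kpar (V : Type*) [Fintype V] : ℝ := Real.log (Fintype.card V)

/-! ### Rooted trees and source-restricted tree covers -/

/-- A rooted tree that is a subgraph of `G`. -/
structure RootedTree {V : Type*} (G : SimpleGraph V) where
  /-- the tree, as a subgraph of `G` -/
  graph : G.Subgraph
  /-- the root -/
  root : V
  root_mem : root ∈ graph.verts
  isTree : graph.coe.IsTree

/-- The depth of `x` in the tree `T`: the weighted distance to the root inside `T`. -/
noncomputable def RootedTree.dep {V : Type*} {G : SimpleGraph V} (w : Sym2 V → ℝ)
    (T : RootedTree G) (x : V) : ℝ :=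
  wdist T.graph.spanningCoe w T.root x

/-- `T` (restricted to the indices in `S`) is an `S`-restricted tree cover of the graph `G - R`,
where `S ⊆ V \ R`. The stretch condition concerns pairs at finite distance. -/
structure IsTreeCover {V : Type*} [Fintype V] (G : SimpleGraph V) (w : Sym2 V → ℝ)
    (R S : Set V) (T : V → RootedTree G) : Prop where
  root_eq : ∀ s ∈ S, (T s).root = s
  subgraph : ∀ s ∈ S, (T s).graph ≤ minus G R
  stretch : ∀ a ∈ S, ∀ b ∉ R, (minus G R).spanningCoe.Reachable a b →
    ∃ s ∈ S, a ∈ (T s).graph.verts ∧ b ∈ (T s).graph.verts ∧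
      (T s).dep w a + (T s).dep w b ≤
        (2 * kpar V - 1) * wdist (minus G R).spanningCoe w a b
  overlap : ∀ b ∉ R, (({s | s ∈ S ∧ b ∈ (T s).graph.verts} : Set V).ncard : ℝ) ≤
    kpar V * (Fintype.card V : ℝ) ^ (1 / kpar V) * (Real.log (Fintype.card V) + 1)

/-- `x` is a trunk vertex of the tree `K` of an `S`-restricted tree cover: it lies on the path in
`K` between two vertices of `S`. -/
def IsTrunk {V : Type*} {G : SimpleGraph V} (K : G.Subgraph) (S : Set V) (x : V) : Prop :=
  ∃ a ∈ S ∩ K.verts, ∃ b ∈ S ∩ K.verts,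
    ∃ q : K.spanningCoe.Walk a b, q.IsPath ∧ x ∈ q.support

/-- The pseudo-degree of `x`: its degree in the subgraph of `K` induced by the trunk vertices
(`0` if `x` is not a trunk vertex). -/
noncomputable def pdeg {V : Type*} {G : SimpleGraph V} (K : G.Subgraph) (S : Set V) (x : V) : ℕ :=
  ((K.induce {y | IsTrunk K S y}).neighborSet x).ncard

/-! ### The high-degree hierarchy

`𝒯 R S` stands for the `S`-restricted tree cover `𝒯(S)` of the graph `G - R`; thus the
notation `𝒯_R(S)` of the hierarchy means `𝒯 R (S \ R)`. -/

/-- The degree threshold `s = 4 e d^{c+1} ln² n + 1`. -/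
noncomputable def threshold (V : Type*) [Fintype V] (d : ℕ) (c : ℝ) : ℝ :=
  4 * Real.exp 1 * (d : ℝ) ^ (c + 1) * Real.log (Fintype.card V) ^ 2 + 1

/-- The set `Hi` of vertices whose pseudo-degree exceeds the threshold in some tree of the
`S`-restricted tree cover `T`. -/
def Hi {V : Type*} [Fintype V] {G : SimpleGraph V} (d : ℕ) (c : ℝ) (S : Set V)
    (T : V → RootedTree G) : Set V :=
  {x | ∃ s ∈ S, threshold V d c < (pdeg (T s).graph S x : ℝ)}

/-- The sets `W_0 = ∅`, `W_1 = Hi(𝒯(A))`, `W_{j+1} = W_j ∪ Hi(𝒯_{W_j}(A))` attached to the node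
`A` of the hierarchy tree. -/
def child {V : Type*} [Fintype V] {G : SimpleGraph V} (𝒯 : Set V → Set V → V → RootedTree G)
    (d : ℕ) (c : ℝ) (A : Set V) : ℕ → Set V
  | 0 => ∅
  | j + 1 => child 𝒯 d c A j ∪
      Hi d c (A \ child 𝒯 d c A j) (𝒯 (child 𝒯 d c A j) (A \ child 𝒯 d c A j))

/-- `U 1, …, U p` is a path in the hierarchy tree that starts at the root `V`, and `U (p+1) = ∅`.
A node `A` with `Hi(𝒯(A)) = ∅` is a leaf; any other node has the children `W_1, …, W_d`. -/
structure IsHierarchyPath {V : Type*} [Fintype V] {G : SimpleGraph V}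
    (𝒯 : Set V → Set V → V → RootedTree G) (d : ℕ) (c : ℝ) (p : ℕ) (U : ℕ → Set V) : Prop where
  one_le : 1 ≤ p
  root : U 1 = Set.univ
  step : ∀ i, 1 ≤ i → i < p →
    (Hi d c (U i) (𝒯 ∅ (U i))).Nonempty ∧ ∃ j, 1 ≤ j ∧ j ≤ d ∧ U (i + 1) = child 𝒯 d c (U i) j
  last : U (p + 1) = ∅

/-! ### The pruned trees -/

/-- The tree obtained from `T` by deleting the vertices of depth more than `(2k-1)ρ`. -/
noncomputable def prune {V : Type*} [Fintype V] {G : SimpleGraph V} (w : Sym2 V → ℝ) (ρ : ℝ)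
    (T : RootedTree G) : G.Subgraph :=
  T.graph.deleteVerts {x | (2 * kpar V - 1) * ρ < T.dep w x}

/-- An indexed family of trees; the tree with index `(i, r)` has root `r` and belongs to a
`src (i, r)`-restricted tree cover. -/
structure TreeFamily {V : Type*} (G : SimpleGraph V) where
  /-- the index set -/
  idx : Set (ℕ × V)
  /-- the trees -/
  tree : ℕ × V → G.Subgraph
  /-- the set to which the tree cover of the tree is restricted -/
  src : ℕ × V → Set V

/-- The family of the pruned trees of `⋃_{1 ≤ i ≤ p} 𝒯_{U_{i+1}}(U_i)`. -/
noncomputable def prunedFamily {V : Type*} [Fintype V] {G : SimpleGraph V} (w : Sym2 V → ℝ)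
    (𝒯 : Set V → Set V → V → RootedTree G) (p : ℕ) (U : ℕ → Set V) (ρ : ℝ) : TreeFamily G where
  idx := {t | 1 ≤ t.1 ∧ t.1 ≤ p ∧ t.2 ∈ U t.1 \ U (t.1 + 1)}
  tree t := prune w ρ (𝒯 (U (t.1 + 1)) (U t.1 \ U (t.1 + 1)) t.2)
  src t := U t.1 \ U (t.1 + 1)

/-! ### Euler tours, covering sets -/

/-- `l` is the sequence of the vertices of `K`, in the order in which some depth-first search that
starts at `r` discovers them: each new vertex is adjacent to the most recently discovered vertex
that still has an undiscovered neighbour. -/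
def IsEulerTour {V : Type*} {G : SimpleGraph V} (K : G.Subgraph) (r : V) (l : List V) : Prop :=
  l.head? = some r ∧ l.Nodup ∧ (∀ x, x ∈ l ↔ x ∈ K.verts) ∧
    ∀ (j : ℕ) (hj : j + 1 < l.length), ∃ (i : ℕ) (hi : i ≤ j),
      K.Adj (l[i]'(by omega)) l[j + 1] ∧
        ∀ (m : ℕ) (hm : m ≤ j), i < m → ∀ y, K.Adj (l[m]'(by omega)) y → y ∈ l.take (j + 1)

/-- A listing of the trees of the family together with an Euler tour of each of them. -/
structure Layout {V : Type*} {G : SimpleGraph V} (F : TreeFamily G) where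
  /-- the order in which the trees are listed -/
  order : List (ℕ × V)
  nodup : order.Nodup
  mem_order : ∀ t, t ∈ order ↔ t ∈ F.idx
  /-- the Euler tours -/
  tour : ℕ × V → List V
  isEulerTour : ∀ t ∈ F.idx, IsEulerTour (F.tree t) t.2 (tour t)

/-- The concatenation `Λ` of the Euler tours. -/
def Layout.seq {V : Type*} {G : SimpleGraph V} {F : TreeFamily G} (L : Layout F) : List V :=
  L.order.flatMap L.tour

/-- The (nonempty) intervals of positions of `Λ`. -/
abbrev Layout.Interval {V : Type*} {G : SimpleGraph V} {F : TreeFamily G} (L : Layout F) : Type :=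
  NonemptyInterval (Fin L.seq.length)

/-- The vertices that occur in an interval of `Λ`. -/
def Layout.vertices {V : Type*} {G : SimpleGraph V} {F : TreeFamily G} (L : Layout F)
    (I : L.Interval) : Set V :=
  {x | ∃ i ∈ I, L.seq.get i = x}

/-- `𝓘` is a `κ`-covering set: each interval is the union of at most `κ` members of `𝓘`. -/
def IsCoveringSet {N : ℕ} (κ : ℕ) (𝓘 : Set (NonemptyInterval (Fin N))) : Prop :=
  ∀ J : NonemptyInterval (Fin N), ∃ A : Finset (NonemptyInterval (Fin N)),
    (A : Set (NonemptyInterval (Fin N))) ⊆ 𝓘 ∧ A.card ≤ κ ∧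
      (⋃ I ∈ A, (I : Set (Fin N))) = (J : Set (Fin N))

/-! ### The auxiliary digraph `H` and the table `E'` -/

/-- The vertices of the digraph `H`: two copies of the intervals, two copies of the trees, and one
copy of `V`. -/
inductive HVertex {V : Type*} {G : SimpleGraph V} {F : TreeFamily G} (L : Layout F) : Type _
  | int₁ (I : L.Interval)
  | tree₁ (t : ℕ × V)
  | vert (x : V)
  | tree₂ (t : ℕ × V)
  | int₂ (I : L.Interval)

/-- There is an edge of `G` of weight at most `ρ` from some vertex of the interval `I` to some
vertex of the tree with index `t`. -/
def Near {V : Type*} {G : SimpleGraph V} (w : Sym2 V → ℝ) (ρ : ℝ) {F : TreeFamily G}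
    (L : Layout F) (I : L.Interval) (t : ℕ × V) : Prop :=
  ∃ x ∈ L.vertices I, ∃ y ∈ (F.tree t).verts, G.Adj x y ∧ w s(x, y) ≤ ρ

/-- The directed edges of `H`. -/
inductive HEdge {V : Type*} {G : SimpleGraph V} (w : Sym2 V → ℝ) (ρ : ℝ) {F : TreeFamily G}
    (L : Layout F) (𝓘 : Set L.Interval) : HVertex L → HVertex L → Prop
  | int_tree (I : L.Interval) (t : ℕ × V) (hI : I ∈ 𝓘) (ht : t ∈ F.idx)
      (h : Near w ρ L I t) : HEdge w ρ L 𝓘 (.int₁ I) (.tree₁ t)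
  | tree_int (I : L.Interval) (t : ℕ × V) (hI : I ∈ 𝓘) (ht : t ∈ F.idx)
      (h : Near w ρ L I t) : HEdge w ρ L 𝓘 (.tree₂ t) (.int₂ I)
  | tree_vert (t : ℕ × V) (x : V) (ht : t ∈ F.idx) (hx : x ∈ (F.tree t).verts) :
      HEdge w ρ L 𝓘 (.tree₁ t) (.vert x)
  | vert_tree (t : ℕ × V) (x : V) (ht : t ∈ F.idx) (hx : x ∈ (F.tree t).verts) :
      HEdge w ρ L 𝓘 (.vert x) (.tree₂ t)

/-- The table `E'`: pairs of positions of `Λ` that carry the same vertex or the end points of an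
edge of weight at most `ρ`. -/
def TableE {V : Type*} {G : SimpleGraph V} (w : Sym2 V → ℝ) (ρ : ℝ) {F : TreeFamily G}
    (L : Layout F) : Set (Fin L.seq.length × Fin L.seq.length) :=
  {z | L.seq.get z.1 = L.seq.get z.2 ∨
    (G.Adj (L.seq.get z.1) (L.seq.get z.2) ∧ w s(L.seq.get z.1, L.seq.get z.2) ≤ ρ)}

/-! ### Affected trees, subtrees and vertices -/

/-- The tree with index `t` is an affected tree. -/
def IsAffectedTree {V : Type*} {G : SimpleGraph V} (F : TreeFamily G) (D : Set V)
    (t : ℕ × V) : Prop :=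
  t ∈ F.idx ∧ ((F.tree t).verts ∩ D).Nonempty

/-- `C` is the vertex set of a connected component of the forest `K - D`. -/
def IsComponent {V : Type*} {G : SimpleGraph V} (K : G.Subgraph) (D C : Set V) : Prop :=
  ∃ x ∈ K.verts \ D, C = {y | (K.deleteVerts D).spanningCoe.Reachable x y}

/-- `C` is (the vertex set of) an affected subtree of the affected tree with index `t`: a component
that contains a trunk vertex. -/
def IsAffectedSubtree {V : Type*} {G : SimpleGraph V} (F : TreeFamily G) (D : Set V)
    (t : ℕ × V) (C : Set V) : Prop :=
  IsAffectedTree F D t ∧ IsComponent (F.tree t) D C ∧ ∃ x ∈ C, IsTrunk (F.tree t) (F.src t) x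

/-- `x` is an affected vertex: it lies in some affected subtree. -/
def IsAffectedVertex {V : Type*} {G : SimpleGraph V} (F : TreeFamily G) (D : Set V)
    (x : V) : Prop :=
  ∃ t C, IsAffectedSubtree F D t C ∧ x ∈ C

/-- There is an unaffected path of length at most `ρ` in `G - D` that connects `X` and `Y`: all its
vertices except possibly the two end points are unaffected. (It may even repeat vertices.) -/
def HasUnaffectedPath {V : Type*} {G : SimpleGraph V} (w : Sym2 V → ℝ) (ρ : ℝ)
    (F : TreeFamily G) (D X Y : Set V) : Prop :=
  ∃ x ∈ X, ∃ y ∈ Y, ∃ q : G.Walk x y, (∀ z ∈ q.support, z ∉ D) ∧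
    (∀ i, 0 < i → i < q.length → ¬ IsAffectedVertex F D (q.getVert i)) ∧ wlen w q ≤ ρ

/-! ### The query graph `R` -/

/-- Labels for the nodes of `R`: the nodes `{u}` and `{v}`, and subtrees `C` of the tree with
index `t`. -/
inductive RNode (V : Type*) : Type _
  | source
  | target
  | sub (t : ℕ × V) (C : Set V)

/-- The vertex set of a node. -/
def RNode.carrier {V : Type*} (u v : V) : RNode V → Set V
  | .source => {u}
  | .target => {v}
  | .sub _ C => C

/-- The node set of `R`: the nodes `{u}` and `{v}`, and all affected subtrees. -/
def RNode.IsNode {V : Type*} {G : SimpleGraph V} (F : TreeFamily G) (D : Set V) :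
    RNode V → Prop
  | .source => True
  | .target => True
  | .sub t C => IsAffectedSubtree F D t C

/-- `rep` represents every node of `R` as a union of intervals from `𝓘`. -/
def IsRepresentation {V : Type*} {G : SimpleGraph V} {F : TreeFamily G} (D : Set V) (u v : V)
    (L : Layout F) (𝓘 : Set L.Interval) (rep : RNode V → Set L.Interval) : Prop :=
  ∀ X : RNode V, X.IsNode F D → rep X ⊆ 𝓘 ∧ X.carrier u v = ⋃ I ∈ rep X, L.vertices I

/-- `a` can reach `b` in `H` after the removal of both copies of every affected tree. -/
def Reaches {V : Type*} {G : SimpleGraph V} (w : Sym2 V → ℝ) (ρ : ℝ) {F : TreeFamily G}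
    (D : Set V) (L : Layout F) (𝓘 : Set L.Interval) : HVertex L → HVertex L → Prop :=
  let removed : Set (HVertex L) :=
    {a | ∃ t, IsAffectedTree F D t ∧ (a = .tree₁ t ∨ a = .tree₂ t)}
  Relation.ReflTransGen fun a b => HEdge w ρ L 𝓘 a b ∧ a ∉ removed ∧ b ∉ removed

/-- The test that the query algorithm performs for the ordered pair `(X, Y)`. -/
def PairTest {V : Type*} {G : SimpleGraph V} (w : Sym2 V → ℝ) (ρ : ℝ) {F : TreeFamily G}
    (D : Set V) (L : Layout F) (𝓘 : Set L.Interval) (rep : RNode V → Set L.Interval)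
    (X Y : RNode V) : Prop :=
  ∃ I ∈ rep X, ∃ J ∈ rep Y,
    Reaches w ρ D L 𝓘 (.int₁ I) (.int₂ J) ∨
      (TableE w ρ L ∩ ((I : Set (Fin L.seq.length)) ×ˢ (J : Set (Fin L.seq.length)))).Nonempty

/-- The (undirected) edge relation `E(R)` on the nodes of `R`. -/
def REdge {V : Type*} {G : SimpleGraph V} (w : Sym2 V → ℝ) (ρ : ℝ) {F : TreeFamily G}
    (D : Set V) (L : Layout F) (𝓘 : Set L.Interval) (rep : RNode V → Set L.Interval)
    (X Y : RNode V) : Prop :=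
  X.IsNode F D ∧ Y.IsNode F D ∧
    (PairTest w ρ D L 𝓘 rep X Y ∨ PairTest w ρ D L 𝓘 rep Y X)

end VSDO

/-! For (a), an unaffected path with at most one edge is recorded in `E'`. On a longer one, consider
the interior, which consists of unaffected vertices. Some level `U i` meets it while `U (i + 1)`
does not (`IsHierarchyPath.exists_last_level`); pick `a` in the interior and in `U i`. Both halves
of the interior, seen from `a`, are walks of length at most `ρ` in `G - U (i + 1)`. The stretch
bound gives a tree through `a` and each end of the interior, with depths small enough to survive
pruning (`IsTreeCover.exists_mem_prune`). As a source, `a` is a trunk vertex of both trees, so it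
would be affected if either tree met `D` (`IsAffectedTree.isAffectedVertex`). Hence both trees
remain in `H`, and the route through them and `a` joins the two intervals.

For (b), every route in `H` has this shape. Unaffected trees avoid `D`, and each is crossed via its
root at cost at most `2(2k-1)ρ`. With the two outer edges this gives `2ρ + 4(2k-1)ρ = (8k-2)ρ`. -/

namespace VSDO

open SimpleGraph

/-! ### Lengths of walks and weighted distance -/

section Walks

variable {V : Type*} {H : SimpleGraph V} {w : Sym2 V → ℝ} {a b c : V}

theorem wlen_nonneg (hw : ∀ e ∈ H.edgeSet, 0 ≤ w e) (q : H.Walk a b) : 0 ≤ wlen w q := by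
  apply List.sum_nonneg
  intro x hx
  obtain ⟨e, he, rfl⟩ := List.mem_map.1 hx
  exact hw e (q.edges_subset_edgeSet he)

@[simp] theorem wlen_nil : wlen w (Walk.nil : H.Walk a a) = 0 := by simp [wlen]

@[simp] theorem wlen_cons (h : H.Adj a b) (q : H.Walk b c) :
    wlen w (Walk.cons h q) = w s(a, b) + wlen w q := by simp [wlen]

@[simp] theorem wlen_append (q : H.Walk a b) (r : H.Walk b c) :
    wlen w (q.append r) = wlen w q + wlen w r := by simp [wlen]

@[simp] theorem wlen_concat (q : H.Walk a b) (h : H.Adj b c) :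
    wlen w (q.concat h) = wlen w q + w s(b, c) := by
  simp [Walk.concat_eq_append]

@[simp] theorem wlen_reverse (q : H.Walk a b) : wlen w q.reverse = wlen w q := by
  simp [wlen, List.sum_reverse]

theorem wlen_takeUntil_le [DecidableEq V] (hw : ∀ e ∈ H.edgeSet, 0 ≤ w e) (q : H.Walk a b)
    (hc : c ∈ q.support) : wlen w (q.takeUntil c hc) ≤ wlen w q := by
  have h := congrArg (wlen w) (q.take_spec hc)
  rw [wlen_append] at h
  linarith [wlen_nonneg hw (q.dropUntil c hc)]

theorem wlen_dropUntil_le [DecidableEq V] (hw : ∀ e ∈ H.edgeSet, 0 ≤ w e) (q : H.Walk a b)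
    (hc : c ∈ q.support) : wlen w (q.dropUntil c hc) ≤ wlen w q := by
  have h := congrArg (wlen w) (q.take_spec hc)
  rw [wlen_append] at h
  linarith [wlen_nonneg hw (q.takeUntil c hc)]

theorem wlen_bypass_le [DecidableEq V] (hw : ∀ e ∈ H.edgeSet, 0 ≤ w e) (q : H.Walk a b) :
    wlen w q.bypass ≤ wlen w q := by
  induction q with
  | nil => simp [Walk.bypass]
  | cons h q ih =>
    have h0 := hw _ (H.mem_edgeSet.2 h)
    rw [wlen_cons, Walk.bypass]
    split_ifs with hs
    · linarith [wlen_dropUntil_le hw q.bypass hs]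
    · rw [wlen_cons]; linarith

theorem wdist_le (hw : ∀ e ∈ H.edgeSet, 0 ≤ w e) (q : H.Walk a b) : wdist H w a b ≤ wlen w q :=
  csInf_le ⟨0, by rintro _ ⟨r, rfl⟩; exact wlen_nonneg hw r⟩ ⟨q, rfl⟩

/-- Connectivity is not needed: the infimum of the empty set is `0`. -/
theorem wdist_nonneg (hw : ∀ e ∈ H.edgeSet, 0 ≤ w e) (a b : V) : 0 ≤ wdist H w a b :=
  Real.sInf_nonneg (by rintro _ ⟨r, rfl⟩; exact wlen_nonneg hw r)

/-- In a finite graph the weighted distance of two connected vertices is attained. -/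
theorem exists_wlen_eq_wdist [Finite V] (hw : ∀ e ∈ H.edgeSet, 0 ≤ w e)
    (hab : H.Reachable a b) : ∃ q : H.Walk a b, wlen w q = wdist H w a b := by
  classical
  have := Fintype.ofFinite V
  -- A path is determined by its duplicate-free support, so there are finitely many. Passing to
  -- `bypass` never lengthens a walk, so a shortest path is a shortest walk.
  have hfin : Finite {q : H.Walk a b // q.IsPath} :=
    Finite.of_injective
      (fun q => (⟨q.1.support, q.2.support_nodup⟩ : {l : List V // l.Nodup}))
      (fun q r h => Subtype.ext (Walk.ext_support (congrArg Subtype.val h)))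
  have hne : Nonempty {q : H.Walk a b // q.IsPath} :=
    hab.elim fun q => ⟨⟨q.bypass, q.bypass_isPath⟩⟩
  obtain ⟨q, hq⟩ := Finite.exists_min fun q : {q : H.Walk a b // q.IsPath} => wlen w q.1
  refine ⟨q.1, le_antisymm ?_ (wdist_le hw _)⟩
  refine le_csInf ⟨_, q.1, rfl⟩ ?_
  rintro _ ⟨r, rfl⟩
  exact (hq ⟨r.bypass, r.bypass_isPath⟩).trans (wlen_bypass_le hw r)

/-- A walk with at least two edges splits into its first edge, its interior and its last edge. -/
theorem exists_interior (q : H.Walk a b) (hq : 2 ≤ q.length) :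
    ∃ (x y : V) (h : H.Adj a x) (r : H.Walk x y) (h' : H.Adj y b),
      q = Walk.cons h (r.concat h') := by
  cases q with
  | nil => simp at hq
  | cons h q =>
    cases q with
    | nil => simp at hq
    | cons h₁ q =>
      obtain ⟨y, r, h', e⟩ := Walk.exists_cons_eq_concat h₁ q
      exact ⟨_, y, h, r, h', by rw [e]⟩

end Walks

/-! ### Pruned trees and tree covers -/

section Trees

variable {V : Type*} {G : SimpleGraph V} {w : Sym2 V → ℝ}

theorem spanningCoe_weight_nonneg (hw : ∀ e ∈ G.edgeSet, 0 < w e) (K : G.Subgraph) :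
    ∀ e ∈ K.spanningCoe.edgeSet, 0 ≤ w e := fun e he =>
  (hw e (SimpleGraph.edgeSet_mono K.spanningCoe_le he)).le

theorem mem_verts_of_mem_support {K : G.Subgraph} {a b z : V} (ha : a ∈ K.verts)
    (q : K.spanningCoe.Walk a b) (hz : z ∈ q.support) : z ∈ K.verts := by
  induction q with
  | nil => simp at hz; exact hz ▸ ha
  | cons h q ih =>
    rcases List.mem_cons.1 (by simpa using hz) with rfl | hz
    · exact ha
    · exact ih h.snd_mem hz

theorem RootedTree.reachable_root (T : RootedTree G) {x : V} (hx : x ∈ T.graph.verts) :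
    T.graph.spanningCoe.Reachable T.root x := by
  have h := T.isTree.connected.preconnected ⟨T.root, T.root_mem⟩ ⟨x, hx⟩
  exact h.map ⟨Subtype.val, fun h => h⟩

/-- A walk between two vertices of a graph `G - R` that avoids `R` lies in `G - R`. -/
theorem exists_walk_minus {R : Set V} {a b : V} (q : G.Walk a b) (hq : ∀ z ∈ q.support, z ∉ R) :
    ∃ r : (minus G R).spanningCoe.Walk a b, wlen w r = wlen w q := by
  have h : ∀ e ∈ q.edges, e ∈ (minus G R).spanningCoe.edgeSet := by
    intro e he
    induction e with
    | _ x y =>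
      simpa [minus, q.adj_of_mem_edges he] using
        ⟨hq x (q.fst_mem_support_of_mem_edges he), hq y (q.snd_mem_support_of_mem_edges he)⟩
  exact ⟨q.transfer _ h, by simp [wlen, Walk.edges_transfer]⟩

/-- Every vertex of a pruned tree is joined to the root by a walk of length at most the pruning
depth that stays in the pruned tree. -/
theorem exists_walk_root [Fintype V] (hw : ∀ e ∈ G.edgeSet, 0 < w e) {ρ : ℝ} (T : RootedTree G)
    {x : V} (hx : x ∈ (prune w ρ T).verts) :
    ∃ q : G.Walk T.root x, (∀ z ∈ q.support, z ∈ (prune w ρ T).verts) ∧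
      wlen w q ≤ (2 * kpar V - 1) * ρ := by
  classical
  obtain ⟨hxT, hxd⟩ : x ∈ T.graph.verts ∧ T.dep w x ≤ (2 * kpar V - 1) * ρ := by
    simpa [prune] using hx
  have hw' := spanningCoe_weight_nonneg hw T.graph
  obtain ⟨q, hq⟩ := exists_wlen_eq_wdist hw' (T.reachable_root hxT)
  change wlen w q = T.dep w x at hq
  refine ⟨q.mapLe T.graph.spanningCoe_le, fun z hz => ?_, ?_⟩
  · have hz' : z ∈ q.support := by simpa using hz
    -- The part of a shortest root walk before `z` bounds the depth of `z`, so pruning keeps the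
    -- whole walk.
    have hd : T.dep w z ≤ (2 * kpar V - 1) * ρ :=
      ((wdist_le hw' _).trans (wlen_takeUntil_le hw' q hz')).trans (hq.le.trans hxd)
    simpa [prune, hd] using mem_verts_of_mem_support T.root_mem q hz'
  · have : wlen w (q.mapLe T.graph.spanningCoe_le) = wlen w q := by simp [wlen]
    rw [this, hq]
    exact hxd

/-- Any two vertices of a pruned tree are joined by a walk in it of length at most twice the
pruning depth. -/
theorem exists_walk_prune [Fintype V] (hw : ∀ e ∈ G.edgeSet, 0 < w e) {ρ : ℝ} (T : RootedTree G)
    {x y : V} (hx : x ∈ (prune w ρ T).verts) (hy : y ∈ (prune w ρ T).verts) :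
    ∃ q : G.Walk x y, (∀ z ∈ q.support, z ∈ (prune w ρ T).verts) ∧
      wlen w q ≤ 2 * ((2 * kpar V - 1) * ρ) := by
  obtain ⟨q, hq, hq'⟩ := exists_walk_root hw T hx
  obtain ⟨r, hr, hr'⟩ := exists_walk_root hw T hy
  refine ⟨q.reverse.append r, fun z hz => ?_, ?_⟩
  · rcases Walk.mem_support_append_iff _ _ |>.1 hz with hz | hz
    · exact hq z (by simpa using hz)
    · exact hr z hz
  · rw [wlen_append, wlen_reverse]
    linarith

/-- This follows from `e < 3`. It makes `2k-1` positive and `8k-2` at least `1`. -/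
theorem one_lt_kpar [Fintype V] (hn : 3 ≤ Fintype.card V) : 1 < kpar V := by
  rw [kpar, Real.lt_log_iff_exp_lt (by positivity)]
  have : (3 : ℝ) ≤ Fintype.card V := by exact_mod_cast hn
  linarith [Real.exp_one_lt_d9]

/-- Vertices joined by a short walk in `G - R` are in a common pruned tree of a tree cover. -/
theorem IsTreeCover.exists_mem_prune [Fintype V] (hn : 3 ≤ Fintype.card V)
    (hw : ∀ e ∈ G.edgeSet, 0 < w e) {R S : Set V} {T : V → RootedTree G}
    (hT : IsTreeCover G w R S T) {ρ : ℝ} {a b : V} (ha : a ∈ S) (q : G.Walk a b)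
    (hq : ∀ z ∈ q.support, z ∉ R) (hl : wlen w q ≤ ρ) :
    ∃ s ∈ S, a ∈ (prune w ρ (T s)).verts ∧ b ∈ (prune w ρ (T s)).verts := by
  obtain ⟨r, hr⟩ := exists_walk_minus (w := w) q hq
  obtain ⟨s, hs, has, hbs, hd⟩ := hT.stretch a ha b (hq b q.end_mem_support) ⟨r⟩
  have hk := one_lt_kpar hn
  have hd' : (2 * kpar V - 1) * wdist (minus G R).spanningCoe w a b ≤ (2 * kpar V - 1) * ρ :=
    mul_le_mul_of_nonneg_left
      (((wdist_le (spanningCoe_weight_nonneg hw _) r).trans hr.le).trans hl) (by linarith)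
  -- The stretch condition bounds only the sum of the two depths; nonnegativity bounds each one.
  have h0 := fun x => wdist_nonneg (spanningCoe_weight_nonneg hw (T s).graph) (T s).root x
  have ha0 : 0 ≤ (T s).dep w a := h0 a
  have hb0 : 0 ≤ (T s).dep w b := h0 b
  refine ⟨s, hs, ?_, ?_⟩
  · simpa [prune, has] using (show (T s).dep w a ≤ (2 * kpar V - 1) * ρ by linarith)
  · simpa [prune, hbs] using (show (T s).dep w b ≤ (2 * kpar V - 1) * ρ by linarith)

end Trees

/-! ### Affected trees and routes in the digraph `H` -/

section Query

variable {V : Type*} {G : SimpleGraph V} {w : Sym2 V → ℝ} {F : TreeFamily G} {ρ : ℝ}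
  {D : Set V} {L : Layout F} {𝓘 : Set L.Interval}

/-- A source vertex outside `D` that lies in an affected tree is affected. -/
theorem IsAffectedTree.isAffectedVertex {t : ℕ × V} (ht : IsAffectedTree F D t) {a : V}
    (ha : a ∈ (F.tree t).verts) (haS : a ∈ F.src t) (haD : a ∉ D) : IsAffectedVertex F D a :=
  -- The affected subtree is the component of `a`; the trivial path from `a` to itself makes `a` a
  -- trunk vertex.
  ⟨t, {y | ((F.tree t).deleteVerts D).spanningCoe.Reachable a y},
    ⟨ht, ⟨a, ⟨ha, haD⟩, rfl⟩, a, Reachable.refl a, a, ⟨haS, ha⟩, a, ⟨haS, ha⟩, Walk.nil,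
      Walk.IsPath.nil, by simp⟩, Reachable.refl a⟩

theorem RNode.IsNode.notMem {X : RNode V} (hX : X.IsNode F D) {u v : V} (hu : u ∉ D)
    (hv : v ∉ D) {x : V} (hx : x ∈ X.carrier u v) : x ∉ D := by
  cases X with
  | source => exact (show x = u from hx) ▸ hu
  | target => exact (show x = v from hx) ▸ hv
  | sub t C =>
    obtain ⟨-, ⟨y, hy, rfl⟩, -⟩ := hX
    obtain ⟨q⟩ : ((F.tree t).deleteVerts D).spanningCoe.Reachable y x := hx
    have := mem_verts_of_mem_support (K := (F.tree t).deleteVerts D) (by simpa using hy) q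
      q.end_mem_support
    simp at this
    exact this.2

/-- In the digraph `H` an interval reaches an interval exactly along two trees that share a
vertex. -/
theorem Reaches.exists_trees {I J : L.Interval}
    (h : Reaches w ρ D L 𝓘 (.int₁ I) (.int₂ J)) :
    ∃ t t' x, t ∈ F.idx ∧ t' ∈ F.idx ∧ ¬ IsAffectedTree F D t ∧ ¬ IsAffectedTree F D t' ∧
      Near w ρ L I t ∧ x ∈ (F.tree t).verts ∧ x ∈ (F.tree t').verts ∧ Near w ρ L J t' := by
  unfold Reaches at h
  -- The edges of `H` go from each of its five layers to the next, so a route between the outer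
  -- layers has exactly four edges.
  rcases Relation.ReflTransGen.cases_head h with h | ⟨_, ⟨h1, -, hr1⟩, h⟩
  · cases h
  cases h1 with | int_tree _ t _ ht hn =>
  rcases Relation.ReflTransGen.cases_head h with h | ⟨_, ⟨h2, -, -⟩, h⟩
  · cases h
  cases h2 with | tree_vert _ x _ hx =>
  rcases Relation.ReflTransGen.cases_head h with h | ⟨_, ⟨h3, -, hr3⟩, h⟩
  · cases h
  cases h3 with | vert_tree t' _ ht' hx' =>
  rcases Relation.ReflTransGen.cases_head h with h | ⟨_, ⟨h4, -, -⟩, h⟩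
  · cases h
  cases h4 with | tree_int J' _ _ _ hn' =>
  rcases Relation.ReflTransGen.cases_head h with h | ⟨_, ⟨h5, -, -⟩, h⟩
  · cases h
    exact ⟨t, t', x, ht, ht', fun h => hr1 ⟨t, h, .inl rfl⟩, fun h => hr3 ⟨t', h, .inr rfl⟩,
      hn, hx, hx', hn'⟩
  · cases h5

theorem reaches_of_trees {I J : L.Interval} (hI : I ∈ 𝓘) (hJ : J ∈ 𝓘) {t t' : ℕ × V} {x : V}
    (ht : t ∈ F.idx) (ht' : t' ∈ F.idx) (hat : ¬ IsAffectedTree F D t)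
    (hat' : ¬ IsAffectedTree F D t') (hn : Near w ρ L I t) (hx : x ∈ (F.tree t).verts)
    (hx' : x ∈ (F.tree t').verts) (hn' : Near w ρ L J t') :
    Reaches w ρ D L 𝓘 (.int₁ I) (.int₂ J) := by
  unfold Reaches
  refine .head ⟨.int_tree I t hI ht hn, ?_, ?_⟩ <| .head ⟨.tree_vert t x ht hx, ?_, ?_⟩ <|
    .head ⟨.vert_tree t' x ht' hx', ?_, ?_⟩ <| .single ⟨.tree_int J t' hJ ht' hn', ?_, ?_⟩ <;>
  · rintro ⟨s, hs, h | h⟩ <;> cases h <;> contradiction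

theorem verts_disjoint_of_not_isAffectedTree {t : ℕ × V} (ht : t ∈ F.idx)
    (h : ¬ IsAffectedTree F D t) {z : V} (hz : z ∈ (F.tree t).verts) : z ∉ D :=
  fun hD => h ⟨ht, z, hz, hD⟩

end Query

/-! ### Completeness and soundness of the query graph -/

section Main

variable {V : Type*} [Fintype V] {G : SimpleGraph V} {w : Sym2 V → ℝ}
  {𝒯 : Set V → Set V → V → RootedTree G} {p : ℕ} {U : ℕ → Set V} {ρ : ℝ}

/-- Every nonempty set of vertices has a last level of the hierarchy path that it meets. -/
theorem IsHierarchyPath.exists_last_level {d : ℕ} {c : ℝ} (hU : IsHierarchyPath 𝒯 d c p U)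
    {A : Set V} (hA : A.Nonempty) :
    ∃ i, 1 ≤ i ∧ i ≤ p ∧ (∃ a ∈ A, a ∈ U i) ∧ ∀ a ∈ A, a ∉ U (i + 1) := by
  by_contra! hcon
  -- Otherwise meeting `A` would propagate from `U 1 = V` to `U (p + 1) = ∅`. No nesting of the
  -- levels is needed.
  have key : ∀ i, i ≤ p → ∃ a ∈ A, a ∈ U (i + 1) := by
    intro i
    induction i with
    | zero =>
      obtain ⟨a, ha⟩ := hA
      exact fun _ => ⟨a, ha, by rw [hU.root]; trivial⟩
    | succ i ih => exact fun hi => hcon (i + 1) (by omega) hi (ih (by omega))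
  obtain ⟨a, -, ha⟩ := key p le_rfl
  rw [hU.last] at ha
  exact ha

/-- An unaffected walk is joined, from each end, to a common vertex by unaffected trees. -/
theorem exists_unaffected_trees (hn : 3 ≤ Fintype.card V) (hw : ∀ e ∈ G.edgeSet, 0 < w e)
    (h𝒯 : ∀ R S : Set V, Disjoint R S → IsTreeCover G w R S (𝒯 R S)) {d : ℕ} {c : ℝ}
    (hU : IsHierarchyPath 𝒯 d c p U) {D : Set V} {x y : V} (r : G.Walk x y)
    (hD : ∀ z ∈ r.support, z ∉ D)
    (haff : ∀ z ∈ r.support, ¬ IsAffectedVertex (prunedFamily w 𝒯 p U ρ) D z)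
    (hl : wlen w r ≤ ρ) :
    ∃ t ∈ (prunedFamily w 𝒯 p U ρ).idx, ∃ t' ∈ (prunedFamily w 𝒯 p U ρ).idx, ∃ a,
      ¬ IsAffectedTree (prunedFamily w 𝒯 p U ρ) D t ∧
      ¬ IsAffectedTree (prunedFamily w 𝒯 p U ρ) D t' ∧
      x ∈ ((prunedFamily w 𝒯 p U ρ).tree t).verts ∧
      a ∈ ((prunedFamily w 𝒯 p U ρ).tree t).verts ∧
      a ∈ ((prunedFamily w 𝒯 p U ρ).tree t').verts ∧
      y ∈ ((prunedFamily w 𝒯 p U ρ).tree t').verts := by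
  classical
  obtain ⟨i, hi1, hip, ⟨a, har, hai⟩, hlast⟩ :=
    hU.exists_last_level (A := {z | z ∈ r.support}) ⟨x, r.start_mem_support⟩
  have har : a ∈ r.support := har
  have hw' : ∀ e ∈ G.edgeSet, 0 ≤ w e := fun e he => (hw e he).le
  have haS : a ∈ U i \ U (i + 1) := ⟨hai, hlast a har⟩
  have hT := h𝒯 (U (i + 1)) (U i \ U (i + 1)) Set.disjoint_sdiff_right
  -- Any tree of this level that contains the source `a` avoids `D`, since `a` is unaffected.
  have hunaff : ∀ s ∈ U i \ U (i + 1),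
      a ∈ (prune w ρ (𝒯 (U (i + 1)) (U i \ U (i + 1)) s)).verts →
      ¬ IsAffectedTree (prunedFamily w 𝒯 p U ρ) D (i, s) := fun s _ has h =>
    haff a har (h.isAffectedVertex has haS (hD a har))
  obtain ⟨s, hs, has, hxs⟩ := hT.exists_mem_prune (ρ := ρ) hn hw haS
    (r.takeUntil a har).reverse
    (fun z hz => hlast z (r.support_takeUntil_subset_support har (by simpa using hz)))
    (by rw [wlen_reverse]; exact (wlen_takeUntil_le hw' r har).trans hl)
  obtain ⟨s', hs', has', hys'⟩ := hT.exists_mem_prune hn hw haS (r.dropUntil a har)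
    (fun z hz => hlast z (r.support_dropUntil_subset_support har hz))
    ((wlen_dropUntil_le hw' r har).trans hl)
  exact ⟨(i, s), ⟨hi1, hip, hs⟩, (i, s'), ⟨hi1, hip, hs'⟩, a, hunaff s hs has,
    hunaff s' hs' has', hxs, has, has', hys'⟩

/-- The end points may be affected, so trees are sought only for the interior and the end edges
become edges of `H`. A path without interior is left to `E'`. -/
theorem pairTest_of_hasUnaffectedPath (hn : 3 ≤ Fintype.card V)
    (hw : ∀ e ∈ G.edgeSet, 0 < w e)
    (h𝒯 : ∀ R S : Set V, Disjoint R S → IsTreeCover G w R S (𝒯 R S)) {d : ℕ} {c : ℝ}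
    (hU : IsHierarchyPath 𝒯 d c p U) {L : Layout (prunedFamily w 𝒯 p U ρ)}
    {𝓘 : Set L.Interval} {D : Set V} {u v : V} {rep : RNode V → Set L.Interval}
    (hrep : IsRepresentation D u v L 𝓘 rep) {X Y : RNode V}
    (hX : X.IsNode (prunedFamily w 𝒯 p U ρ) D) (hY : Y.IsNode (prunedFamily w 𝒯 p U ρ) D)
    (h : HasUnaffectedPath w ρ (prunedFamily w 𝒯 p U ρ) D (X.carrier u v) (Y.carrier u v)) :
    PairTest w ρ D L 𝓘 rep X Y := by
  obtain ⟨x, hx, y, hy, q, hqD, hqU, hl⟩ := h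
  have hw' : ∀ e ∈ G.edgeSet, 0 ≤ w e := fun e he => (hw e he).le
  obtain ⟨hX𝓘, hXc⟩ := hrep X hX
  obtain ⟨hY𝓘, hYc⟩ := hrep Y hY
  rw [hXc] at hx
  rw [hYc] at hy
  obtain ⟨I, hI, hxI⟩ := Set.mem_iUnion₂.1 hx
  obtain ⟨J, hJ, hyJ⟩ := Set.mem_iUnion₂.1 hy
  refine ⟨I, hI, J, hJ, ?_⟩
  by_cases hlen : 2 ≤ q.length
  · left
    obtain ⟨x', y', h, r, h', rfl⟩ := exists_interior q hlen
    rw [wlen_cons, wlen_concat] at hl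
    have h0 := hw' _ (G.mem_edgeSet.2 h)
    have h0' := hw' _ (G.mem_edgeSet.2 h')
    have hr0 := wlen_nonneg hw' r
    obtain ⟨t, ht, t', ht', a, hat, hat', hxt, hta, hta', hyt'⟩ :=
      exists_unaffected_trees hn hw h𝒯 hU (D := D) (ρ := ρ) r
        (fun z hz => hqD z (by simp [hz]))
        (fun z hz => by
          -- Vertex `m` of the interior is vertex `m + 1` of the whole path.
          obtain ⟨m, rfl, hm⟩ := Walk.mem_support_iff_exists_getVert.1 hz
          have := hqU (m + 1) (by omega) (by simpa using by omega)
          rwa [Walk.getVert_cons_succ, Walk.concat_eq_append, Walk.getVert_append',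
            if_pos hm] at this)
        (by linarith)
    exact reaches_of_trees (hX𝓘 hI) (hY𝓘 hJ) ht ht' hat hat'
      ⟨x, hxI, x', hxt, h, by linarith⟩ hta hta'
      ⟨y, hyJ, y', hyt', h'.symm, by rw [Sym2.eq_swap]; linarith⟩
  · right
    obtain ⟨i, hi, rfl⟩ := hxI
    obtain ⟨j, hj, rfl⟩ := hyJ
    refine ⟨(i, j), ?_, hi, hj⟩
    generalize hgi : L.seq.get i = a at q
    generalize hgj : L.seq.get j = b at q
    cases q with
    | nil => exact .inl (hgi.trans hgj.symm)
    | cons h q =>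
      cases q with
      | nil =>
        refine .inr ?_
        simp only [hgi, hgj]
        exact ⟨h, by simpa using hl⟩
      | cons h₁ q => simp at hlen

/-- An edge of the query graph yields a path in `G - D`. -/
theorem exists_path_of_pairTest (hn : 3 ≤ Fintype.card V)
    (hw : ∀ e ∈ G.edgeSet, 0 < w e) (hρ : 0 ≤ ρ) {L : Layout (prunedFamily w 𝒯 p U ρ)}
    {𝓘 : Set L.Interval} {D : Set V} {u v : V} (hu : u ∉ D) (hv : v ∉ D)
    {rep : RNode V → Set L.Interval}
    (hrep : IsRepresentation D u v L 𝓘 rep) {X Y : RNode V}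
    (hX : X.IsNode (prunedFamily w 𝒯 p U ρ) D) (hY : Y.IsNode (prunedFamily w 𝒯 p U ρ) D)
    (h : PairTest w ρ D L 𝓘 rep X Y) :
    ∃ x ∈ X.carrier u v, ∃ y ∈ Y.carrier u v, ∃ q : G.Walk x y,
      q.IsPath ∧ (∀ z ∈ q.support, z ∉ D) ∧ wlen w q ≤ (8 * kpar V - 2) * ρ := by
  classical
  have hw' : ∀ e ∈ G.edgeSet, 0 ≤ w e := fun e he => (hw e he).le
  have hk := one_lt_kpar hn
  -- A walk suffices: `bypass` turns it into a path without adding vertices or length.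
  suffices h : ∃ x ∈ X.carrier u v, ∃ y ∈ Y.carrier u v, ∃ q : G.Walk x y,
      (∀ z ∈ q.support, z ∉ D) ∧ wlen w q ≤ (8 * kpar V - 2) * ρ by
    obtain ⟨x, hx, y, hy, q, hq, hl⟩ := h
    exact ⟨x, hx, y, hy, q.bypass, q.bypass_isPath,
      fun z hz => hq z (q.support_bypass_subset_support hz), (wlen_bypass_le hw' q).trans hl⟩
  obtain ⟨I, hI, J, hJ, h⟩ := h
  have hIX : ∀ x ∈ L.vertices I, x ∈ X.carrier u v := fun x hx => by
    rw [(hrep X hX).2]; exact Set.mem_biUnion hI hx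
  have hJY : ∀ x ∈ L.vertices J, x ∈ Y.carrier u v := fun x hx => by
    rw [(hrep Y hY).2]; exact Set.mem_biUnion hJ hx
  rcases h with h | ⟨⟨i, j⟩, he, hi, hj⟩
  · obtain ⟨t, t', m, ht, ht', hat, hat', ⟨x, hx, x', hx', hadj, hwt⟩, hm, hm',
      ⟨y, hy, y', hy', hadj', hwt'⟩⟩ := h.exists_trees
    obtain ⟨q, hq, hql⟩ := exists_walk_prune hw _ hx' hm
    obtain ⟨r, hr, hrl⟩ := exists_walk_prune hw _ hm' hy'
    refine ⟨x, hIX x hx, y, hJY y hy, Walk.cons hadj ((q.append r).concat hadj'.symm), ?_, ?_⟩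
    · intro z hz
      simp only [Walk.support_cons, Walk.support_concat, List.mem_cons, List.mem_append,
        Walk.mem_support_append_iff, List.not_mem_nil, or_false] at hz
      rcases hz with rfl | (hz | hz) | rfl
      · exact hX.notMem hu hv (hIX _ hx)
      · exact verts_disjoint_of_not_isAffectedTree ht hat (hq z hz)
      · exact verts_disjoint_of_not_isAffectedTree ht' hat' (hr z hz)
      · exact hY.notMem hu hv (hJY _ hy)
    · rw [Sym2.eq_swap] at hwt'
      rw [wlen_cons, wlen_concat, wlen_append]
      linarith
  · have hxX := hIX _ ⟨i, hi, rfl⟩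
    have hyY := hJY _ ⟨j, hj, rfl⟩
    have hxD := hX.notMem hu hv hxX
    have hyD := hY.notMem hu hv hyY
    -- A hit in `E'` costs at most one edge of weight `ρ`, within the bound because `8k-2 ≥ 1`.
    have hle : ρ ≤ (8 * kpar V - 2) * ρ := le_mul_of_one_le_left hρ (by linarith)
    rcases he with he | ⟨hadj, hwt⟩
    · refine ⟨_, hxX, _, he ▸ hyY, Walk.nil, ?_, ?_⟩
      · simpa using hxD
      · rw [wlen_nil]; linarith
    · refine ⟨_, hxX, _, hyY, Walk.cons hadj Walk.nil, ?_, ?_⟩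
      · intro z hz
        simp only [Walk.support_cons, Walk.support_nil, List.mem_cons, List.not_mem_nil,
          or_false] at hz
        rcases hz with rfl | rfl
        · exact hxD
        · exact hyD
      · rw [wlen_cons, wlen_nil]; linarith

end Main

end VSDO

theorem mainTheorem8 {V : Type*} [Fintype V] (hn : 3 ≤ Fintype.card V)
    (G : SimpleGraph V) (w : Sym2 V → ℝ) (hw : ∀ e ∈ G.edgeSet, 0 < w e)
    (d : ℕ) (hd : 2 ≤ d) (c : ℝ) (hc : 1 ≤ c)
    (𝒯 : Set V → Set V → V → VSDO.RootedTree G)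
    (h𝒯 : ∀ R S : Set V, Disjoint R S → VSDO.IsTreeCover G w R S (𝒯 R S))
    (p : ℕ) (U : ℕ → Set V) (hU : VSDO.IsHierarchyPath 𝒯 d c p U)
    (ρ : ℝ) (hρ : 0 ≤ ρ)
    (L : VSDO.Layout (VSDO.prunedFamily w 𝒯 p U ρ))
    (κ : ℕ) (𝓘 : Set L.Interval) (h𝓘 : VSDO.IsCoveringSet κ 𝓘)
    (D : Set V) (hD : D.ncard ≤ d) (u v : V) (hu : u ∉ D) (hv : v ∉ D)
    (rep : VSDO.RNode V → Set L.Interval)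
    (hrep : VSDO.IsRepresentation D u v L 𝓘 rep)
    (X Y : VSDO.RNode V)
    (hX : X.IsNode (VSDO.prunedFamily w 𝒯 p U ρ) D)
    (hY : Y.IsNode (VSDO.prunedFamily w 𝒯 p U ρ) D) :
    (VSDO.HasUnaffectedPath w ρ (VSDO.prunedFamily w 𝒯 p U ρ) D
        (X.carrier u v) (Y.carrier u v) →
      VSDO.REdge w ρ D L 𝓘 rep X Y) ∧
    (VSDO.REdge w ρ D L 𝓘 rep X Y →
      ∃ x ∈ X.carrier u v, ∃ y ∈ Y.carrier u v, ∃ q : G.Walk x y,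
        q.IsPath ∧ (∀ z ∈ q.support, z ∉ D) ∧
          VSDO.wlen w q ≤ (8 * VSDO.kpar V - 2) * ρ) := by
  refine ⟨fun h => ⟨hX, hY, .inl
    (VSDO.pairTest_of_hasUnaffectedPath hn hw h𝒯 hU hrep hX hY h)⟩, ?_⟩
  -- If the test succeeded for `(Y, X)`, the resulting path is reversed.
  rintro ⟨-, -, h | h⟩
  · exact VSDO.exists_path_of_pairTest hn hw hρ hu hv hrep hX hY h
  · obtain ⟨y, hy, x, hx, q, hq, hqD, hl⟩ :=
      VSDO.exists_path_of_pairTest hn hw hρ hu hv hrep hY hX h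
    exact ⟨x, hx, y, hy, q.reverse, hq.reverse, fun z hz => hqD z (by simpa using hz),
      (VSDO.wlen_reverse q).le.trans hl⟩
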